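/- All graphs are finite and non-empty, have no loops and may have parallel edges; every edge has one of the two colours $1,2$ (a 2-edge-coloured graph). A path is alternating if consecutive edges have different colours; a cycle has at least three vertices, and it is alternating if cyclically consecutive edges have different colours. An alternating cycle of $G$ is hamiltonian if it contains all vertices of $G$, and an alternating cycle factor of $G$ is a collection of pairwise vertex-disjoint alternating cycles of $G$ that together cover $V(G)$. The graph $G$ is colour-connected if for all distinct vertices $u,v$ there are two alternating $(u,v)$-paths $P_1,P_2$ such that the closed walk that follows $P_1$ from $u$ to $v$ and then $P_2$ backwards from $v$ to $u$ is alternating (its last and first edge included). A 2-edge-coloured graph is M-closed if, whenever $x,y,z$ are distinct vertices and there are an edge $xy$ and an edge $yz$ of the same colour, $x$ and $z$ are adjacent. An extension of a 2-edge-coloured graph $G_0$ with vertices $v_1,\dots,v_n$ is a graph obtained from $G_0$ by replacing each $v_i$ by an independent set $I_i$ of $p_i\ge 1$ vertices and each edge $v_iv_j$ of colour $c$ by edges of colour $c$, one between each vertex of $I_i$ and each vertex of $I_j$. **Theorem.** Let $G$ be an extension of an M-closed 2-edge-coloured graph. Then $G$ has an alternating hamiltonian cycle if and only if $G$ is colour-connected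 and has an alternating cycle factor. -/

import Mathlib

/-! Multigraphs are `Graph α β` (vertices in `α`, edges in `β`, parallel edges allowed).
A 2-edge-colouring is a function `φ : β → Fin 2`; only its values on edges of the graph matter. -/

namespace Graph

/-- `G.IsWalkList u w v`: the list `w = [(e₁, x₁), …, (eₖ, xₖ)]` describes the walk
`u e₁ x₁ e₂ x₂ … eₖ xₖ = v` of `G`. -/
def IsWalkList {α β : Type*} (G : Graph α β) : α → List (β × α) → α → Prop
  | u, [], v => u ∈ G.vertexSet ∧ u = v
  | u, (e, x) :: w, v => G.IsLink e u x ∧ G.IsWalkList x w v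

/-- The sequence of colours of the edges of a walk. -/
def colourSeq {α β : Type*} (φ : β → Fin 2) (w : List (β × α)) : List (Fin 2) :=
  w.map fun s => φ s.1

/-- `w` is an alternating `(u, v)`-path: a walk from `u` to `v` without repeated vertices,
in which consecutive edges have different colours. -/
structure IsAltPath {α β : Type*} (G : Graph α β) (φ : β → Fin 2)
    (u : α) (w : List (β × α)) (v : α) : Prop where
  walk : G.IsWalkList u w v
  nodup : (u :: w.map Prod.snd).Nodup
  alternating : (colourSeq φ w).IsChain (· ≠ ·)

/-- `w` is an alternating cycle: a closed walk on at least three vertices, in which no vertex is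
repeated (except that the walk returns to its start) and cyclically consecutive edges, including
the last and the first one, have different colours. -/
structure IsAltCycle {α β : Type*} (G : Graph α β) (φ : β → Fin 2)
    (w : List (β × α)) : Prop where
  closed : ∃ u, G.IsWalkList u w u
  three_le : 3 ≤ w.length
  nodup : (w.map Prod.snd).Nodup
  alternating : Cycle.Chain (· ≠ ·) (colourSeq φ w : Cycle (Fin 2))

/-- The vertex set of a cycle given as a list of steps. -/
def cycleVerts {α β : Type*} (w : List (β × α)) : Set α :=
  {x | x ∈ w.map Prod.snd}

/-- `G` has an alternating hamiltonian cycle. -/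
def HasAltHamCycle {α β : Type*} (G : Graph α β) (φ : β → Fin 2) : Prop :=
  ∃ w, G.IsAltCycle φ w ∧ cycleVerts w = G.vertexSet

/-- `G` has an alternating cycle factor: a collection of disjoint alternating cycles that
cover all vertices. -/
def HasAltCycleFactor {α β : Type*} (G : Graph α β) (φ : β → Fin 2) : Prop :=
  ∃ C : Set (List (β × α)), (∀ w ∈ C, G.IsAltCycle φ w) ∧ C.PairwiseDisjoint cycleVerts ∧
    ⋃ w ∈ C, cycleVerts w = G.vertexSet

/-- `G` is colour-connected: any two distinct vertices `u`, `v` are joined by two alternating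
`(u, v)`-paths `p`, `q` whose union, that is, the closed walk which follows `p` from `u` to `v`
and then `q` backwards from `v` to `u`, is alternating (as a closed walk). -/
def ColourConnected {α β : Type*} (G : Graph α β) (φ : β → Fin 2) : Prop :=
  ∀ u ∈ G.vertexSet, ∀ v ∈ G.vertexSet, u ≠ v →
    ∃ p q, G.IsAltPath φ u p v ∧ G.IsAltPath φ u q v ∧
      Cycle.Chain (· ≠ ·) (colourSeq φ p ++ (colourSeq φ q).reverse : Cycle (Fin 2))

/-- `G` is M-closed: the end-vertices of every monochromatic path with two edges are adjacent. -/
def MClosed {α β : Type*} (G : Graph α β) (φ : β → Fin 2) : Prop :=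
  ∀ e f x y z, G.IsLink e x y → G.IsLink f y z → x ≠ y → y ≠ z → x ≠ z → φ e = φ f → G.Adj x z

/-- `H` (coloured by `ψ`) is an extension of the loopless multigraph `G` (coloured by `φ`): each
vertex `v` of `G` is replaced by the non-empty set of the vertices `x` of `H` with `π x = v`, and
there are as many edges of colour `c` between `x` and `y` in `H` as there are between `π x` and
`π y` in `G`. In particular there are none if `π x = π y`, so the sets are independent. -/
def IsExtension {α β γ δ : Type*} (G : Graph α β) (φ : β → Fin 2)
    (H : Graph γ δ) (ψ : δ → Fin 2) : Prop :=
  ∃ π : γ → α, π '' H.vertexSet = G.vertexSet ∧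
    ∀ x ∈ H.vertexSet, ∀ y ∈ H.vertexSet, ∀ c : Fin 2,
      {f | H.IsLink f x y ∧ ψ f = c}.encard = {e | G.IsLink e (π x) (π y) ∧ φ e = c}.encard

end Graph

/-!
Among the alternating cycle factors take one in which no two or more cycles can be merged into a
single one. If `xy` is an edge of colour `c` between two of its cycles, and `u`, `v` are the
neighbours of `x`, `y` along the edges of colour `c` of their cycles, then `uv` is not an edge of
colour `c`, as it would merge the two cycles. For the same reason vertices of different cycles are
never twins, so `u`, `y` and `x`, `v` are adjacent by M-closedness. Counting the edges between the
cycles, one sees that the inequalities this gives hold with equality everywhere. Hence two cycles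
with an edge between them are completely joined, and as they cannot be merged, one of them dominates
the other: each of its vertices sends edges of a single colour to the other cycle, and these colours
alternate along it. Domination is transitive and acyclic, so by colour-connectedness some cycle
dominates all the others, with the same colours. An alternating walk that starts on this cycle with
the other colour can never leave it, so there are no other cycles.
-/

namespace AltColour

section Abstract

variable {V : Type*} {H : Bool → SimpleGraph V}

theorem adj_iSup {c : Bool} {x y : V} (h : (H c).Adj x y) : (iSup H).Adj x y :=
  le_iSup H c h

theorem adj_of_not_adj_not {d : Bool} {x y : V} (h : (iSup H).Adj x y)
    (h' : ¬ (H (!d)).Adj x y) : (H d).Adj x y := by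
  obtain ⟨e, he⟩ := SimpleGraph.iSup_adj.1 h
  obtain rfl | rfl := Bool.eq_or_eq_not e d
  · exact he
  · exact absurd he h'

/-- `AltSegment H c S a b`: there is an alternating path from `a` to `b` with vertex set `S` whose
first and last edge have the colour `!c`, so that it can be prolonged at both ends by edges of
colour `c`. -/
inductive AltSegment (H : Bool → SimpleGraph V) (c : Bool) : Set V → V → V → Prop
  | edge {a b : V} : (H (!c)).Adj a b → AltSegment H c {a, b} a b
  | append {S T : Set V} {a b d e : V} : AltSegment H c S a b → AltSegment H c T d e →
      Disjoint S T → (H c).Adj b d → AltSegment H c (S ∪ T) a e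

theorem AltSegment.symm {c : Bool} {S : Set V} {a b : V} (h : AltSegment H c S a b) :
    AltSegment H c S b a := by
  induction h with
  | edge h => rw [Set.pair_comm]; exact .edge h.symm
  | append _ _ hd h ih₁ ih₂ => rw [Set.union_comm]; exact ih₂.append ih₁ hd.symm h.symm

/-- `S` is the vertex set of an alternating closed trail through each vertex of `S` once; this is
an alternating cycle or, if `S` has only two vertices, a pair of parallel edges. -/
def AltClosed (H : Bool → SimpleGraph V) (S : Set V) : Prop :=
  ∃ c a b, AltSegment H c S a b ∧ (H c).Adj b a

/-- The condition that extensions of M-closed graphs inherit: the ends of a monochromatic path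
with two edges are adjacent unless they are twins. -/
def MClosedUpToTwins (H : Bool → SimpleGraph V) : Prop :=
  ∀ c x y z, (H c).Adj x y → (H c).Adj y z →
    (iSup H).Adj x z ∨ ∀ d w, (H d).Adj x w ↔ (H d).Adj z w

/-- A cover of the vertices by disjoint alternating cycles, each with an orientation: `next x` is
the vertex after `x` on its cycle, and `col x` is the colour of the edge from `x` to `next x`. -/
structure AltCycleFactor (H : Bool → SimpleGraph V) where
  next : Equiv.Perm V
  col : V → Bool
  adj_next : ∀ x, (H (col x)).Adj x (next x)
  col_next : ∀ x, col (next x) = !col x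
  next_next_ne : ∀ x, next (next x) ≠ x

namespace AltCycleFactor

variable (F : AltCycleFactor H)

/-- The vertex set of the cycle of the factor through `x`. -/
def cycle (x : V) : Set V := {z | F.next.SameCycle x z}

variable {F} in
theorem mem_cycle {x z : V} : z ∈ F.cycle x ↔ F.cycle z = F.cycle x := by
  refine ⟨fun h => ?_, fun h => ?_⟩
  · ext w
    exact ⟨h.trans, h.symm.trans⟩
  · rw [← h]
    exact Equiv.Perm.SameCycle.refl _ _

theorem self_mem_cycle (x : V) : x ∈ F.cycle x := mem_cycle.2 rfl

variable {F} in
theorem disjoint_cycle {x y : V} (h : F.cycle x ≠ F.cycle y) :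
    Disjoint (F.cycle x) (F.cycle y) :=
  Set.disjoint_left.2 fun _ hx hy => h ((mem_cycle.1 hx).symm.trans (mem_cycle.1 hy))

theorem cycle_next (x : V) : F.cycle (F.next x) = F.cycle x :=
  mem_cycle.1 ((Equiv.Perm.SameCycle.refl _ _).apply_right)

theorem cycle_symm_next (x : V) : F.cycle (F.next.symm x) = F.cycle x := by
  rw [← F.cycle_next, Equiv.apply_symm_apply]

theorem col_symm_next (x : V) : F.col (F.next.symm x) = !F.col x := by
  rw [← Bool.not_not (F.col (F.next.symm x)), ← F.col_next, Equiv.apply_symm_apply]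

/-- The same cycles with the opposite orientation. -/
@[simps next col]
def reverse : AltCycleFactor H where
  next := F.next.symm
  col x := !F.col x
  adj_next x := by
    have h := F.adj_next (F.next.symm x)
    rw [F.col_symm_next, Equiv.apply_symm_apply] at h
    exact h.symm
  col_next x := by rw [F.col_symm_next]
  next_next_ne x h := F.next_next_ne x <| by
    rw [Equiv.symm_apply_eq, Equiv.symm_apply_eq] at h
    exact h.symm

theorem cycle_reverse (x : V) : F.reverse.cycle x = F.cycle x := by
  ext z
  exact Equiv.Perm.sameCycle_inv

/-- The neighbour of `x` on its cycle along the edge of colour `c`. -/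
def partner (c : Bool) (x : V) : V :=
  if F.col x = c then F.next x else F.next.symm x

theorem partner_eq_next {x : V} : F.partner (F.col x) x = F.next x := if_pos rfl

theorem partner_reverse (c : Bool) (x : V) : F.reverse.partner c x = F.partner c x := by
  by_cases h : F.col x = c <;> simp [partner, h]

theorem cycle_partner (c : Bool) (x : V) : F.cycle (F.partner c x) = F.cycle x := by
  unfold partner
  split_ifs
  exacts [F.cycle_next x, F.cycle_symm_next x]

theorem col_partner (c : Bool) (x : V) : F.col (F.partner c x) = !F.col x := by
  unfold partner
  split_ifs
  exacts [F.col_next x, F.col_symm_next x]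

theorem adj_partner (c : Bool) (x : V) : (H c).Adj x (F.partner c x) := by
  by_cases h : F.col x = c
  · simpa only [partner, h, if_true] using F.adj_next x
  · have hcol : F.reverse.col x = c := Bool.not_eq.2 h
    simpa only [partner, h, if_false, hcol, reverse_next] using F.reverse.adj_next x

theorem partner_partner (c : Bool) (x : V) : F.partner c (F.partner c x) = x := by
  by_cases h : F.col x = c <;>
    simp [partner, h, F.col_next, F.col_symm_next]

theorem partner_ne_partner (x : V) : F.partner true x ≠ F.partner false x := by
  have hne : F.next x ≠ F.next.symm x := fun h =>
    F.next_next_ne x (by rw [h, Equiv.apply_symm_apply])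
  cases h : F.col x <;> simpa [partner, h, eq_comm] using hne

/-- Two steps along the cycle. As it always leaves along the edge of colour `false`, its direction
depends on the colour of `x`; it permutes the vertices of one cycle with equal `col`. -/
def rotate (x : V) : V := F.partner true (F.partner false x)

theorem cycle_rotate (x : V) : F.cycle (F.rotate x) = F.cycle x := by
  simp only [rotate, cycle_partner]

theorem col_rotate (x : V) : F.col (F.rotate x) = F.col x := by
  simp only [rotate, col_partner, Bool.not_not]

theorem rotate_ne (x : V) : F.rotate x ≠ x := fun h =>
  F.partner_ne_partner x <| by
    rw [← F.partner_partner true (F.partner false x)]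
    exact congrArg (F.partner true) h.symm

theorem rotate_injective : Function.Injective F.rotate :=
  (Function.LeftInverse.injective (F.partner_partner true)).comp
    (Function.LeftInverse.injective (F.partner_partner false))

theorem rotate_reverse (x : V) : F.reverse.rotate x = F.rotate x := by
  simp only [rotate, partner_reverse]

theorem rotate_of_col_eq_false {x : V} (h : F.col x = false) :
    F.rotate x = F.next (F.next x) := by
  simp [rotate, partner, h, F.col_next]

theorem col_iterate_next (n : ℕ) (x : V) : F.col (F.next^[n] x) = F.col x ↔ Even n := by
  induction n with
  | zero => simp
  | succ n ih =>
    rw [Function.iterate_succ_apply', F.col_next, Nat.even_add_one, ← ih, Bool.not_eq]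

theorem cycle_iterate_next (n : ℕ) (x : V) : F.cycle (F.next^[n] x) = F.cycle x := by
  induction n with
  | zero => rfl
  | succ n ih => rw [Function.iterate_succ_apply', F.cycle_next, ih]

/-- The `n` vertices that follow `x` on its cycle. -/
def arc (x : V) (n : ℕ) : Set V := (fun k => F.next^[k + 1] x) '' Set.Iio n

theorem arc_add (x : V) (m n : ℕ) :
    F.arc x (m + n) = F.arc x m ∪ F.arc (F.next^[m] x) n := by
  have hIio : Set.Iio (m + n) = Set.Iio m ∪ (fun k => k + m) '' Set.Iio n := by
    ext k
    simp only [Set.mem_Iio, Set.mem_union, Set.mem_image]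
    constructor
    · intro hk
      by_cases h : k < m
      · exact .inl h
      · exact .inr ⟨k - m, by lia, by lia⟩
    · rintro (h | ⟨l, hl, rfl⟩) <;> lia
  rw [arc, hIio, Set.image_union, Set.image_image]
  simp only [arc, ← Function.iterate_add_apply, add_right_comm]

theorem iterate_period_next (x : V) : F.next^[Function.minimalPeriod F.next x] x = x :=
  Function.iterate_minimalPeriod

theorem injOn_iterate_succ (x : V) :
    Set.InjOn (fun k => F.next^[k + 1] x) (Set.Iio (Function.minimalPeriod F.next x)) := by
  intro i hi j hj h
  simp only [Function.iterate_succ_apply'] at h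
  exact Function.iterate_injOn_Iio_minimalPeriod hi hj (F.next.injective h)

theorem disjoint_arc {x : V} {m n : ℕ} (h : m + n ≤ Function.minimalPeriod F.next x) :
    Disjoint (F.arc x m) (F.arc (F.next^[m] x) n) := by
  rw [Set.disjoint_left]
  rintro _ ⟨i, hi, rfl⟩ ⟨j, hj, hij⟩
  simp only [← Function.iterate_add_apply, add_right_comm j 1 m] at hij
  simp only [Set.mem_Iio] at hi hj
  have := F.injOn_iterate_succ x (Set.mem_Iio.2 (by lia : j + m < _)) (Set.mem_Iio.2 (by lia)) hij
  lia

theorem altSegment_arc (x : V) {m : ℕ} (hm : 0 < m)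
    (h : m + m ≤ Function.minimalPeriod F.next x) :
    AltSegment H (F.col x) (F.arc x (m + m)) (F.next x) (F.next^[m + m] x) := by
  have edge : ∀ y, AltSegment H (F.col y) (F.arc y 2) (F.next y) (F.next (F.next y)) := by
    intro y
    have harc : F.arc y 2 = {F.next y, F.next (F.next y)} := by
      ext z
      simp [arc, Nat.le_one_iff_eq_zero_or_eq_one, eq_comm]
    rw [harc]
    exact .edge (F.col_next y ▸ F.adj_next (F.next y))
  induction m, hm using Nat.le_induction with
  | base => exact edge x
  | succ m _ ih =>
    have hcol : F.col (F.next^[m + m] x) = F.col x := (F.col_iterate_next _ x).2 ⟨m, rfl⟩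
    have hlast := edge (F.next^[m + m] x)
    have hadj := F.adj_next (F.next^[m + m] x)
    rw [hcol] at hlast hadj
    rw [show m + 1 + (m + 1) = m + m + 2 by lia, F.arc_add, Function.iterate_succ_apply',
      Function.iterate_succ_apply']
    exact (ih (by lia)).append hlast (F.disjoint_arc (by lia)) hadj

section Finite

variable [Finite V]

theorem minimalPeriod_next_pos (x : V) : 0 < Function.minimalPeriod F.next x :=
  Function.minimalPeriod_pos_of_mem_periodicPts (F.next.injective.mem_periodicPts x)

theorem exists_iterate_next {x y : V} (h : F.cycle x = F.cycle y) :
    ∃ n < Function.minimalPeriod F.next x, F.next^[n] x = y := by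
  obtain ⟨n, hn⟩ := (mem_cycle.2 h.symm : F.next.SameCycle x y).exists_nat_pow_eq
  refine ⟨n % _, Nat.mod_lt _ (F.minimalPeriod_next_pos x), ?_⟩
  rw [Function.iterate_mod_minimalPeriod_eq, Equiv.Perm.iterate_eq_pow, hn]

variable {F} in
theorem rotate_induction {P : V → Prop} {x y : V} (hcycle : F.cycle x = F.cycle y)
    (hcol : F.col x = F.col y) (base : P x)
    (step : ∀ z, F.cycle z = F.cycle x → P z → P (F.rotate z)) : P y := by
  wlog hx : F.col x = false generalizing F
  · refine this (F := F.reverse) ?_ ?_ ?_ ?_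
    · simpa only [cycle_reverse] using hcycle
    · simp only [reverse_col, hcol]
    · simpa only [cycle_reverse, rotate_reverse] using step
    · exact Bool.not_eq.2 hx
  obtain ⟨n, -, rfl⟩ := F.exists_iterate_next hcycle
  obtain ⟨m, rfl⟩ := (F.col_iterate_next n x).1 hcol.symm
  clear hcol hcycle
  induction m with
  | zero => exact base
  | succ m ih =>
    have hrotate : F.rotate (F.next^[m + m] x) = F.next^[m + 1 + (m + 1)] x := by
      rw [F.rotate_of_col_eq_false, show m + 1 + (m + 1) = m + m + 1 + 1 by lia,
        Function.iterate_succ_apply', Function.iterate_succ_apply']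
      rw [(F.col_iterate_next _ x).2 ⟨m, rfl⟩, hx]
    rw [← hrotate]
    exact step _ (F.cycle_iterate_next _ x) ih

theorem arc_period (x : V) : F.arc x (Function.minimalPeriod F.next x) = F.cycle x := by
  ext z
  rw [mem_cycle]
  constructor
  · rintro ⟨k, -, rfl⟩
    exact F.cycle_iterate_next _ x
  · intro h
    have hpred : F.cycle x = F.cycle (F.next.symm z) := by rw [cycle_symm_next, h]
    obtain ⟨n, hn, h⟩ := F.exists_iterate_next hpred
    exact ⟨n, hn, by simp only [Function.iterate_succ_apply', h, Equiv.apply_symm_apply]⟩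

theorem altSegment_cycle (c : Bool) (x : V) : AltSegment H c (F.cycle x) (F.partner c x) x := by
  wlog hx : F.col x = c generalizing F
  · rw [← cycle_reverse, ← partner_reverse]
    exact this F.reverse (Bool.not_eq.2 hx)
  subst hx
  obtain ⟨m, hm⟩ := (F.col_iterate_next _ x).1 (congrArg F.col (F.iterate_period_next x))
  have hpos := F.minimalPeriod_next_pos x
  have h := F.altSegment_arc x (m := m) (by lia) hm.ge
  rwa [← hm, F.arc_period, F.iterate_period_next, ← partner_eq_next] at h

theorem exists_altSegment_split (c : Bool) {x t : V} (hcycle : F.cycle x = F.cycle t)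
    (hcol : F.col x = F.col t) (hne : x ≠ t) :
    ∃ S T, Disjoint S T ∧ S ∪ T = F.cycle x ∧ AltSegment H c S (F.partner c x) t ∧
      AltSegment H c T (F.partner c t) x := by
  wlog hx : F.col x = c generalizing F
  · simp only [← F.cycle_reverse, ← F.partner_reverse] at hcycle ⊢
    exact this F.reverse hcycle (congrArg (! ·) hcol) (Bool.not_eq.2 hx)
  subst hx
  obtain ⟨n, hn, rfl⟩ := F.exists_iterate_next hcycle
  obtain ⟨m, rfl⟩ := (F.col_iterate_next n x).1 hcol.symm
  have hm : 0 < m := by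
    by_contra hm
    exact hne (by simp [Nat.eq_zero_of_not_pos hm])
  obtain ⟨p, hp⟩ := (F.col_iterate_next _ x).1 (congrArg F.col (F.iterate_period_next x))
  obtain ⟨l, hl, rfl⟩ : ∃ l, 0 < l ∧ p = m + l := ⟨p - m, by lia, by lia⟩
  have hperiod : Function.minimalPeriod F.next (F.next^[m + m] x) =
      Function.minimalPeriod F.next x :=
    Function.minimalPeriod_apply_iterate (F.next.injective.mem_periodicPts x) _
  refine ⟨F.arc x (m + m), F.arc (F.next^[m + m] x) (l + l), F.disjoint_arc (by lia), ?_, ?_, ?_⟩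
  · rw [← F.arc_add, ← F.arc_period]
    congr 1; lia
  · rw [partner_eq_next]
    exact F.altSegment_arc x hm hn.le
  · have h := F.altSegment_arc (F.next^[m + m] x) hl (by lia)
    rw [← Function.iterate_add_apply, show l + l + (m + m) = m + l + (m + l) by lia, ← hp,
      iterate_period_next, ← partner_eq_next] at h
    rwa [hcol]

end Finite

end AltCycleFactor


/-- An alternating cycle factor of which no two or more cycles can be merged into a single one. -/
structure IrreducibleFactor (H : Bool → SimpleGraph V) extends AltCycleFactor H where
  not_altClosed : ∀ T : Set V, (∀ z ∈ T, toAltCycleFactor.cycle z ⊆ T) → ∀ x ∈ T, ∀ y ∈ T,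
    toAltCycleFactor.cycle x ≠ toAltCycleFactor.cycle y → ¬ AltClosed H T

/-- `AltReach H c u v`: there is an alternating walk from `u` to `v` whose first edge has the
colour `c`. -/
inductive AltReach (H : Bool → SimpleGraph V) : Bool → V → V → Prop
  | single {c : Bool} {u v : V} : (H c).Adj u v → AltReach H c u v
  | cons {c : Bool} {u w v : V} : (H c).Adj u w → AltReach H (!c) w v → AltReach H c u v

namespace IrreducibleFactor

open AltCycleFactor

variable [Finite V] (F : IrreducibleFactor H)

section Merging

omit [Finite V]

theorem not_altClosed_union {x y : V} (hxy : F.cycle x ≠ F.cycle y) :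
    ¬ AltClosed H (F.cycle x ∪ F.cycle y) := by
  refine F.not_altClosed _ ?_ x (.inl (F.self_mem_cycle x)) y (.inr (F.self_mem_cycle y)) hxy
  rintro z (hz | hz) <;> rw [mem_cycle.1 hz]
  exacts [Set.subset_union_left, Set.subset_union_right]

theorem not_altClosed_union_union {x y : V} (z : V) (hxy : F.cycle x ≠ F.cycle y) :
    ¬ AltClosed H (F.cycle x ∪ F.cycle y ∪ F.cycle z) := by
  refine F.not_altClosed _ ?_ x (.inl (.inl (F.self_mem_cycle x))) y
    (.inl (.inr (F.self_mem_cycle y))) hxy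
  rintro w ((hw | hw) | hw) <;> rw [mem_cycle.1 hw]
  exacts [Set.subset_union_left.trans Set.subset_union_left,
    Set.subset_union_right.trans Set.subset_union_left, Set.subset_union_right]

end Merging

theorem not_adj_partner_partner {c : Bool} {x y : V} (hxy : F.cycle x ≠ F.cycle y)
    (h : (H c).Adj x y) : ¬ (H c).Adj (F.partner c x) (F.partner c y) := fun h' =>
  F.not_altClosed_union hxy ⟨c, _, _, (F.altSegment_cycle c x).append
    (F.altSegment_cycle c y).symm (disjoint_cycle hxy) h, h'.symm⟩

theorem not_twins {x y : V} (hxy : F.cycle x ≠ F.cycle y) :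
    ¬ ∀ d w, (H d).Adj x w ↔ (H d).Adj y w := by
  intro h
  have hx : (H true).Adj x (F.partner true y) := (h _ _).2 (F.adj_partner _ _)
  have hy : (H true).Adj y (F.partner true x) := (h _ _).1 (F.adj_partner _ _)
  refine F.not_adj_partner_partner (by rwa [cycle_partner]) hx ?_
  rw [partner_partner]
  exact hy.symm

theorem adj_iSup_of_adj_of_adj (hH : MClosedUpToTwins H) {c : Bool} {x y z : V}
    (hxz : F.cycle x ≠ F.cycle z) (h₁ : (H c).Adj x y) (h₂ : (H c).Adj y z) :
    (iSup H).Adj x z :=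
  (hH c x y z h₁ h₂).resolve_right (F.not_twins hxz)

section Counting

open Classical in
/-- The adjacency relation of a graph as a function with values `0` and `1`. -/
noncomputable def adjIndicator (A : SimpleGraph V) (x y : V) : ℕ := if A.Adj x y then 1 else 0

theorem two_mul_adjIndicator_le (hH : MClosedUpToTwins H) (c : Bool) {x y : V}
    (hxy : F.cycle x ≠ F.cycle y) :
    2 * (adjIndicator (H c) x y + adjIndicator (H c) (F.partner c x) (F.partner c y)) ≤
      adjIndicator (iSup H) (F.partner c x) y + adjIndicator (iSup H) x (F.partner c y) := by
  have hcross : ∀ {u v}, F.cycle u ≠ F.cycle v → (H c).Adj u v →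
      (iSup H).Adj (F.partner c u) v ∧ (iSup H).Adj u (F.partner c v) := fun {u v} huv h =>
    ⟨F.adj_iSup_of_adj_of_adj hH (by rwa [cycle_partner]) (F.adj_partner c u).symm h,
      F.adj_iSup_of_adj_of_adj hH (by rwa [cycle_partner]) h (F.adj_partner c v)⟩
  unfold adjIndicator
  by_cases h : (H c).Adj x y
  · obtain ⟨h₁, h₂⟩ := hcross hxy h
    simp [h, h₁, h₂, F.not_adj_partner_partner hxy h]
  by_cases h' : (H c).Adj (F.partner c x) (F.partner c y)
  · obtain ⟨h₁, h₂⟩ := hcross (by simpa only [cycle_partner] using hxy) h'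
    rw [partner_partner] at h₁ h₂
    simp [h, h', h₁, h₂]
  · simp [h, h']

omit [Finite V] in
theorem adjIndicator_iSup_le (x y : V) :
    adjIndicator (iSup H) x y ≤ adjIndicator (H true) x y + adjIndicator (H false) x y := by
  by_cases h : (iSup H).Adj x y
  · obtain ⟨_ | _, hd⟩ := SimpleGraph.iSup_adj.1 h <;> simp [adjIndicator, h, hd]
  · simp only [adjIndicator, h, if_false, zero_le]

open Classical in
/-- The pairs of vertices in different cycles of the factor, over which edges are counted. -/
noncomputable def crossPairs [Fintype V] : Finset (V × V) := {q | F.cycle q.1 ≠ F.cycle q.2}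

omit [Finite V] in
theorem mem_crossPairs [Fintype V] {q : V × V} :
    q ∈ F.crossPairs ↔ F.cycle q.1 ≠ F.cycle q.2 := by
  simp [crossPairs]

omit [Finite V] in
theorem sum_partner_left [Fintype V] (c : Bool) (g : V → V → ℕ) :
    ∑ q ∈ F.crossPairs, g (F.partner c q.1) q.2 = ∑ q ∈ F.crossPairs, g q.1 q.2 := by
  refine Finset.sum_nbij' (fun q => (F.partner c q.1, q.2)) (fun q => (F.partner c q.1, q.2))
    ?_ ?_ ?_ ?_ ?_ <;> simp [mem_crossPairs, cycle_partner, partner_partner]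

omit [Finite V] in
theorem sum_partner_right [Fintype V] (c : Bool) (g : V → V → ℕ) :
    ∑ q ∈ F.crossPairs, g q.1 (F.partner c q.2) = ∑ q ∈ F.crossPairs, g q.1 q.2 := by
  refine Finset.sum_nbij' (fun q => (q.1, F.partner c q.2)) (fun q => (q.1, F.partner c q.2))
    ?_ ?_ ?_ ?_ ?_ <;> simp [mem_crossPairs, cycle_partner, partner_partner]

omit [Finite V] in
theorem two_mul_sum_adjIndicator_le [Fintype V] (hH : MClosedUpToTwins H) (c : Bool) :
    2 * ∑ q ∈ F.crossPairs, adjIndicator (H c) q.1 q.2 ≤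
      ∑ q ∈ F.crossPairs, adjIndicator (iSup H) q.1 q.2 := by
  have h := Finset.sum_le_sum fun q hq =>
    F.two_mul_adjIndicator_le hH c (F.mem_crossPairs.1 hq)
  rw [← Finset.mul_sum, Finset.sum_add_distrib, Finset.sum_add_distrib,
    F.sum_partner_left c fun x y => adjIndicator (H c) x (F.partner c y),
    F.sum_partner_right, F.sum_partner_left, F.sum_partner_right] at h
  lia

omit [Finite V] in
theorem sum_adjIndicator_iSup_le [Fintype V] :
    ∑ q ∈ F.crossPairs, adjIndicator (iSup H) q.1 q.2 ≤
      ∑ q ∈ F.crossPairs, adjIndicator (H true) q.1 q.2 +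
        ∑ q ∈ F.crossPairs, adjIndicator (H false) q.1 q.2 := by
  rw [← Finset.sum_add_distrib]
  exact Finset.sum_le_sum fun q _ => adjIndicator_iSup_le q.1 q.2

theorem adjIndicator_iSup_eq (hH : MClosedUpToTwins H) {x y : V} (hxy : F.cycle x ≠ F.cycle y) :
    adjIndicator (iSup H) x y = adjIndicator (H true) x y + adjIndicator (H false) x y := by
  have := Fintype.ofFinite V
  refine (Finset.sum_eq_sum_iff_of_le fun q _ => adjIndicator_iSup_le (H := H) q.1 q.2).1 ?_ (x, y)
    (F.mem_crossPairs.2 hxy)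
  have htrue := F.two_mul_sum_adjIndicator_le hH true
  have hfalse := F.two_mul_sum_adjIndicator_le hH false
  have hle := F.sum_adjIndicator_iSup_le
  rw [Finset.sum_add_distrib]
  lia

theorem two_mul_adjIndicator_eq (hH : MClosedUpToTwins H) (c : Bool) {x y : V}
    (hxy : F.cycle x ≠ F.cycle y) :
    2 * (adjIndicator (H c) x y + adjIndicator (H c) (F.partner c x) (F.partner c y)) =
      adjIndicator (iSup H) (F.partner c x) y + adjIndicator (iSup H) x (F.partner c y) := by
  have := Fintype.ofFinite V
  refine (Finset.sum_eq_sum_iff_of_le fun q hq =>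
    F.two_mul_adjIndicator_le hH c (F.mem_crossPairs.1 hq)).1 ?_ (x, y) (F.mem_crossPairs.2 hxy)
  rw [← Finset.mul_sum, Finset.sum_add_distrib, Finset.sum_add_distrib,
    F.sum_partner_left c fun x y => adjIndicator (H c) x (F.partner c y),
    F.sum_partner_right, F.sum_partner_left, F.sum_partner_right]
  have htrue := F.two_mul_sum_adjIndicator_le hH true
  have hfalse := F.two_mul_sum_adjIndicator_le hH false
  have hle := F.sum_adjIndicator_iSup_le
  cases c <;> lia

theorem colour_eq_of_adj (hH : MClosedUpToTwins H) {d e : Bool} {x y : V}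
    (hxy : F.cycle x ≠ F.cycle y) (h : (H d).Adj x y) (h' : (H e).Adj x y) : d = e := by
  by_contra hne
  have hboth : (H true).Adj x y ∧ (H false).Adj x y := by
    cases d <;> cases e <;> simp_all
  have hsum := F.adjIndicator_iSup_eq hH hxy
  simp [adjIndicator, adj_iSup h, hboth] at hsum

omit [Finite V] in
theorem adjIndicator_le_one (A : SimpleGraph V) (x y : V) : adjIndicator A x y ≤ 1 := by
  unfold adjIndicator
  split_ifs <;> simp

omit [Finite V] in
theorem adjIndicator_eq_one {A : SimpleGraph V} {x y : V} : adjIndicator A x y = 1 ↔ A.Adj x y := by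
  simp [adjIndicator]

omit [Finite V] in
theorem adjIndicator_le_iSup (c : Bool) (x y : V) :
    adjIndicator (H c) x y ≤ adjIndicator (iSup H) x y := by
  by_cases h : (H c).Adj x y
  · simp only [adjIndicator, h, adj_iSup h, if_true, le_refl]
  · simp only [adjIndicator, h, if_false, zero_le]

/-- The two equations `two_mul_adjIndicator_eq` for `x, y` and for `partner c x, y` are compared
modulo `2`. -/
theorem adj_partner_block (hH : MClosedUpToTwins H) (c : Bool) {x y : V}
    (hxy : F.cycle x ≠ F.cycle y) (h : (iSup H).Adj x y) :
    (iSup H).Adj (F.partner c x) y ∧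
      adjIndicator (H c) x y + adjIndicator (H c) (F.partner c x) (F.partner c y) = 1 := by
  have hself := F.two_mul_adjIndicator_eq hH c hxy
  have hpartner := F.two_mul_adjIndicator_eq hH c (x := F.partner c x) (y := y)
    (by rwa [cycle_partner])
  rw [partner_partner, adjIndicator_eq_one.2 h] at hpartner
  have hle₁ := adjIndicator_le_iSup (H := H) c (F.partner c x) y
  have hle₂ := adjIndicator_le_iSup (H := H) c x (F.partner c y)
  have hone₁ := adjIndicator_le_one (iSup H) (F.partner c x) y
  have hone₂ := adjIndicator_le_one (iSup H) x (F.partner c y)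
  rw [← adjIndicator_eq_one]
  lia

end Counting

theorem partner_left_adj_iSup (hH : MClosedUpToTwins H) (c : Bool) {x y : V}
    (hxy : F.cycle x ≠ F.cycle y) (h : (iSup H).Adj x y) : (iSup H).Adj (F.partner c x) y :=
  (F.adj_partner_block hH c hxy h).1

theorem partner_right_adj_iSup (hH : MClosedUpToTwins H) (c : Bool) {x y : V}
    (hxy : F.cycle x ≠ F.cycle y) (h : (iSup H).Adj x y) : (iSup H).Adj x (F.partner c y) :=
  (F.partner_left_adj_iSup hH c hxy.symm h.symm).symm

theorem adj_partner_partner (hH : MClosedUpToTwins H) {d : Bool} (c : Bool) {x y : V}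
    (hxy : F.cycle x ≠ F.cycle y) (h : (H d).Adj x y) :
    (H (!d)).Adj (F.partner c x) (F.partner c y) := by
  have hblock := (F.adj_partner_block hH c hxy (adj_iSup h)).2
  obtain rfl | rfl := Bool.eq_or_eq_not d c
  · refine adj_of_not_adj_not ?_ ?_
    · exact F.partner_right_adj_iSup hH d (by rwa [cycle_partner])
        (F.partner_left_adj_iSup hH d hxy (adj_iSup h))
    · rw [Bool.not_not]
      exact F.not_adj_partner_partner hxy h
  · have hc : ¬ (H c).Adj x y := fun h' => by simpa using F.colour_eq_of_adj hH hxy h h'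
    rw [Bool.not_not, ← adjIndicator_eq_one]
    simpa [adjIndicator, hc] using hblock

section Classes

theorem adj_rotate_rotate_iff (hH : MClosedUpToTwins H) {d : Bool} {x y : V}
    (hxy : F.cycle x ≠ F.cycle y) : (H d).Adj (F.rotate x) (F.rotate y) ↔ (H d).Adj x y := by
  have hpartner : ∀ {u v} (c d), F.cycle u ≠ F.cycle v →
      ((H (!d)).Adj (F.partner c u) (F.partner c v) ↔ (H d).Adj u v) := by
    intro u v c d huv
    refine ⟨fun h => ?_, F.adj_partner_partner hH c huv⟩
    simpa only [partner_partner, Bool.not_not] using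
      F.adj_partner_partner hH c (by simpa only [cycle_partner] using huv) h
  rw [← hpartner false d hxy, ← hpartner true (!d) (by simpa only [cycle_partner] using hxy),
    Bool.not_not, rotate, rotate]

/-- Otherwise the two cycles, cut at `x, t` and at `y, w`, could be joined to a single one by the
edges `xy`, `tw` and the edges between the partners of `x, w` and of `t, y`. -/
theorem not_adj_of_checkerboard (hH : MClosedUpToTwins H) {c : Bool} {x t y w : V}
    (hxt : F.cycle x = F.cycle t) (hxt' : F.col x = F.col t) (hyw : F.cycle y = F.cycle w)
    (hyw' : F.col y = F.col w) (hxy : F.cycle x ≠ F.cycle y) (h₁ : (H c).Adj x y)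
    (h₂ : (H (!c)).Adj x w) (h₃ : (H (!c)).Adj t y) : ¬ (H c).Adj t w := by
  intro h₄
  have hne₁ : x ≠ t := by
    rintro rfl
    simpa using F.colour_eq_of_adj hH hxy h₁ h₃
  have hne₂ : y ≠ w := by
    rintro rfl
    simpa using F.colour_eq_of_adj hH hxy h₁ h₂
  obtain ⟨S, T, hST, hx, hS, hT⟩ := F.exists_altSegment_split c hxt hxt' hne₁
  obtain ⟨S', T', hdisj', hy, hS', hT'⟩ := F.exists_altSegment_split c hyw hyw' hne₂
  have hdisj := disjoint_cycle hxy
  rw [← hx, ← hy, Set.disjoint_union_left, Set.disjoint_union_right,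
    Set.disjoint_union_right] at hdisj
  obtain ⟨⟨hSS', hST'⟩, hTS', hTT'⟩ := hdisj
  have hxw := F.adj_partner_partner hH c (hyw ▸ hxy) h₂
  have hty := F.adj_partner_partner hH c (hxt ▸ hxy) h₃
  rw [Bool.not_not] at hxw hty
  have hmerge := (hT.append hT'.symm hTT' h₁).append (hS.append hS'.symm hSS' h₄)
    (by
      rw [Set.disjoint_union_left, Set.disjoint_union_right, Set.disjoint_union_right]
      exact ⟨⟨hST.symm, hTS'⟩, hST'.symm, hdisj'.symm⟩) hxw.symm
  refine F.not_altClosed_union hxy ⟨c, _, _, ?_, hty.symm⟩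
  rwa [← hx, ← hy, show S ∪ T ∪ (S' ∪ T') = T ∪ T' ∪ (S ∪ S') by ac_rfl]

theorem adj_iSup_class_right (hH : MClosedUpToTwins H) {x y z : V} (hxy : F.cycle x ≠ F.cycle y)
    (h : (iSup H).Adj x y) (hyz : F.cycle y = F.cycle z) (hyz' : F.col y = F.col z) :
    (iSup H).Adj x z := by
  refine rotate_induction hyz hyz' h fun w hw h => ?_
  have hxw : F.cycle x ≠ F.cycle w := hw ▸ hxy
  exact F.partner_right_adj_iSup hH true (by rwa [cycle_partner])
    (F.partner_right_adj_iSup hH false hxw h)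

theorem adj_rotate_left (hH : MClosedUpToTwins H) {d : Bool} {x y : V}
    (hxy : F.cycle x ≠ F.cycle y) (h : (H d).Adj x y) : (H d).Adj (F.rotate x) y := by
  by_contra hnot
  have h' : (H (!d)).Adj (F.rotate x) y := by
    refine adj_of_not_adj_not ?_ (by rwa [Bool.not_not])
    exact F.partner_left_adj_iSup hH true (by rwa [cycle_partner])
      (F.partner_left_adj_iSup hH false hxy (adj_iSup h))
  let N (v : V) : Set V := {w | F.cycle y = F.cycle w ∧ F.col y = F.col w ∧ (H d).Adj v w}
  have hN : N (F.rotate x) = F.rotate '' N x := by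
    ext w
    obtain ⟨z, rfl⟩ := Finite.surjective_of_injective F.rotate_injective w
    rw [F.rotate_injective.mem_set_image]
    simp only [N, Set.mem_ofPred_eq, cycle_rotate, col_rotate]
    exact and_congr_right fun hz => and_congr_right fun _ =>
      F.adj_rotate_rotate_iff hH (hz ▸ hxy)
  obtain ⟨w, ⟨hyw, hyw', hw⟩, hwx⟩ : ∃ w ∈ N (F.rotate x), w ∉ N x := by
    by_contra! hsub
    have heq : N (F.rotate x) = N x := Set.eq_of_subset_of_ncard_le hsub
      (by rw [hN, Set.ncard_image_of_injective _ F.rotate_injective])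
    have hy : y ∈ N (F.rotate x) := heq ▸ ⟨rfl, rfl, h⟩
    exact hnot hy.2.2
  have hxw : (H (!d)).Adj x w := by
    refine adj_of_not_adj_not (F.adj_iSup_class_right hH hxy (adj_iSup h) hyw hyw') fun hd => ?_
    rw [Bool.not_not] at hd
    exact hwx ⟨hyw, hyw', hd⟩
  exact F.not_adj_of_checkerboard hH (F.cycle_rotate x).symm (F.col_rotate x).symm hyw hyw' hxy
    h hxw h' hw

theorem adj_class_left (hH : MClosedUpToTwins H) {d : Bool} {x y z : V}
    (hxy : F.cycle x ≠ F.cycle y) (h : (H d).Adj x y) (hxz : F.cycle x = F.cycle z)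
    (hxz' : F.col x = F.col z) : (H d).Adj z y :=
  rotate_induction (P := fun w => (H d).Adj w y) hxz hxz' h fun _ hw h =>
    F.adj_rotate_left hH (hw ▸ hxy) h

theorem adj_class_right (hH : MClosedUpToTwins H) {d : Bool} {x y z : V}
    (hxy : F.cycle x ≠ F.cycle y) (h : (H d).Adj x y) (hyz : F.cycle y = F.cycle z)
    (hyz' : F.col y = F.col z) : (H d).Adj x z :=
  (F.adj_class_left hH hxy.symm h.symm hyz hyz').symm

end Classes

/-- The vertex `x` is joined by edges of colour `c` to all vertices of another cycle, that
of `y`. -/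
def Dominates (c : Bool) (x y : V) : Prop :=
  F.cycle x ≠ F.cycle y ∧ ∀ z, F.cycle z = F.cycle y → (H c).Adj x z

namespace Dominates

variable {F} {c d : Bool} {x y z : V}

omit [Finite V] in
theorem congr_right (h : F.Dominates c x y) (hyz : F.cycle y = F.cycle z) : F.Dominates c x z :=
  ⟨hyz ▸ h.1, hyz ▸ h.2⟩

theorem same_class (hH : MClosedUpToTwins H) (h : F.Dominates c x y)
    (hxz : F.cycle x = F.cycle z) (hxz' : F.col x = F.col z) : F.Dominates c z y :=
  ⟨hxz ▸ h.1, fun w hw => F.adj_class_left hH (hw ▸ h.1) (h.2 w hw) hxz hxz'⟩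

theorem partner (hH : MClosedUpToTwins H) (h : F.Dominates c x y) (e : Bool) :
    F.Dominates (!c) (F.partner e x) y := by
  refine ⟨by rw [cycle_partner]; exact h.1, fun z hz => ?_⟩
  have hz' : F.cycle (F.partner e z) = F.cycle y := (F.cycle_partner e z).trans hz
  simpa only [partner_partner] using F.adj_partner_partner hH e (hz' ▸ h.1) (h.2 _ hz')

theorem other_class (hH : MClosedUpToTwins H) (h : F.Dominates c x y)
    (hxz : F.cycle x = F.cycle z) (hxz' : F.col x ≠ F.col z) : F.Dominates (!c) z y :=
  (h.partner hH true).same_class hH ((F.cycle_partner _ _).trans hxz)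
    ((F.col_partner _ _).trans (Bool.not_eq.2 hxz'))

theorem exists_colour (hH : MClosedUpToTwins H) (h : F.Dominates c x y) (d : Bool) :
    ∃ w, F.cycle w = F.cycle x ∧ F.Dominates d w y := by
  obtain rfl | rfl := Bool.eq_or_eq_not d c
  · exact ⟨x, rfl, h⟩
  · exact ⟨F.partner true x, F.cycle_partner _ _, h.partner hH true⟩

theorem adj_iSup {x' y' : V} (hH : MClosedUpToTwins H) (h : F.Dominates c x y)
    (hx : F.cycle x = F.cycle x') (hy : F.cycle y = F.cycle y') : (iSup H).Adj x' y' := by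
  by_cases hcol : F.col x = F.col x'
  · exact AltColour.adj_iSup ((h.same_class hH hx hcol).2 _ hy.symm)
  · exact AltColour.adj_iSup ((h.other_class hH hx hcol).2 _ hy.symm)

theorem asymm {x' : V} (hH : MClosedUpToTwins H) (h : F.Dominates c x y)
    (hx : F.cycle x = F.cycle x') : ¬ F.Dominates d y x' := by
  intro h'
  have hpartner := h.partner hH true
  have hd := F.colour_eq_of_adj hH h.1 (h.2 y rfl) (h'.2 x hx).symm
  have hd' := F.colour_eq_of_adj hH hpartner.1 (hpartner.2 y rfl)
    (h'.2 _ ((F.cycle_partner _ _).trans hx)).symm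
  simp [hd] at hd'

theorem adj_iSup_of_dominates (hH : MClosedUpToTwins H) (h : F.Dominates c x y)
    (h' : F.Dominates d y z) (hxz : F.cycle x ≠ F.cycle z) : (iSup H).Adj x z := by
  obtain ⟨y', hy', hd⟩ := h'.exists_colour hH c
  exact F.adj_iSup_of_adj_of_adj hH hxz (h.2 y' hy') (hd.2 z rfl)

/-- Otherwise the cycles of `x` and `z` could be inserted into the cycle of `y`, in the two gaps
between `y` and `rotate y`. -/
theorem colour_eq (hH : MClosedUpToTwins H) (h : F.Dominates c y x) (h' : F.Dominates d y z) :
    c = d := by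
  by_cases hxz : F.cycle x = F.cycle z
  · exact F.colour_eq_of_adj hH h.1 (h.2 x rfl) (h'.2 x hxz)
  by_contra hne
  obtain rfl : d = !c := Bool.eq_not.2 (Ne.symm hne)
  obtain ⟨S, T, hST, hy, hS, hT⟩ := F.exists_altSegment_split c (F.cycle_rotate y).symm
    (F.col_rotate y).symm (F.rotate_ne y).symm
  have hrotate := h.same_class hH (F.cycle_rotate y).symm (F.col_rotate y).symm
  have hpartner := h'.partner hH c
  have hpartner' := (h'.same_class hH (F.cycle_rotate y).symm (F.col_rotate y).symm).partner hH c
  rw [Bool.not_not] at hpartner hpartner'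
  have hyx := disjoint_cycle h.1
  have hyz := disjoint_cycle h'.1
  rw [← hy, Set.disjoint_union_left] at hyx hyz
  have hx := hT.append (F.altSegment_cycle c x).symm hyx.2 (h.2 x rfl)
  have hz := hS.symm.append (F.altSegment_cycle c z).symm hyz.1 (hpartner.2 z rfl)
  have hmerge := hx.append hz (by
    rw [Set.disjoint_union_left, Set.disjoint_union_right, Set.disjoint_union_right]
    exact ⟨⟨hST.symm, hyz.2⟩, hyx.1.symm, disjoint_cycle hxz⟩)
    (hrotate.2 _ (F.cycle_partner c x)).symm
  refine F.not_altClosed_union_union z h.1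
    ⟨c, _, _, ?_, (hpartner'.2 _ (F.cycle_partner c z)).symm⟩
  rwa [← hy, show S ∪ T ∪ F.cycle x ∪ F.cycle z = T ∪ F.cycle x ∪ (S ∪ F.cycle z) by ac_rfl]

theorem not_triangle (h₁ : F.Dominates c x y) (h₂ : F.Dominates c y z) :
    ¬ F.Dominates c z x := by
  intro h₃
  have hxyz : Disjoint (F.cycle x ∪ F.cycle y) (F.cycle z) := by
    rw [Set.disjoint_union_left]
    exact ⟨(disjoint_cycle h₃.1).symm, disjoint_cycle h₂.1⟩
  have hmerge := ((F.altSegment_cycle c x).append (F.altSegment_cycle c y) (disjoint_cycle h₁.1)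
    (h₁.2 _ (F.cycle_partner c y))).append (F.altSegment_cycle c z) hxyz
    (h₂.2 _ (F.cycle_partner c z))
  exact F.not_altClosed_union_union z h₁.1 ⟨c, _, _, hmerge, h₃.2 _ (F.cycle_partner c x)⟩

end Dominates

theorem dominates_or_dominates (hH : MClosedUpToTwins H) {x y : V} (hxy : F.cycle x ≠ F.cycle y)
    (h : (iSup H).Adj x y) : ∃ c, F.Dominates c x y ∨ F.Dominates c y x := by
  have hcycle : ∀ {u v}, F.cycle v = F.cycle u → F.cycle (F.partner false u) = F.cycle v :=
    fun h => (F.cycle_partner _ _).trans h.symm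
  have hcol : ∀ {u v}, F.col u ≠ F.col v → F.col (F.partner false u) = F.col v := fun h =>
    (F.col_partner _ _).trans (Bool.not_eq.2 h)
  obtain ⟨c, hc⟩ := SimpleGraph.iSup_adj.1 h
  obtain ⟨d, hd⟩ := SimpleGraph.iSup_adj.1 (F.partner_right_adj_iSup hH false hxy h)
  have hxy' : F.cycle x ≠ F.cycle (F.partner false y) := by rwa [cycle_partner]
  refine ⟨c, ?_⟩
  obtain rfl | rfl := Bool.eq_or_eq_not d c
  · refine .inl ⟨hxy, fun z hz => ?_⟩
    by_cases hyz : F.col y = F.col z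
    · exact F.adj_class_right hH hxy hc hz.symm hyz
    · exact F.adj_class_right hH hxy' hd (hcycle hz) (hcol hyz)
  · refine .inr ⟨hxy.symm, fun z hz => SimpleGraph.Adj.symm ?_⟩
    have hd' := F.adj_partner_partner hH false hxy' hd
    rw [partner_partner, Bool.not_not] at hd'
    by_cases hxz : F.col x = F.col z
    · exact F.adj_class_left hH hxy hc hz.symm hxz
    · exact F.adj_class_left hH (by rwa [cycle_partner]) hd' (hcycle hz) (hcol hxz)

theorem adj_iSup_congr (hH : MClosedUpToTwins H) {x y x' y' : V} (hxy : F.cycle x ≠ F.cycle y)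
    (h : (iSup H).Adj x y) (hx : F.cycle x = F.cycle x') (hy : F.cycle y = F.cycle y') :
    (iSup H).Adj x' y' := by
  obtain ⟨c, h | h⟩ := F.dominates_or_dominates hH hxy h
  · exact h.adj_iSup hH hx hy
  · exact (h.adj_iSup hH hy hx).symm

theorem adj_iSup_trans (hH : MClosedUpToTwins H) {x y z : V} (hxy : F.cycle x ≠ F.cycle y)
    (hyz : F.cycle y ≠ F.cycle z) (hxz : F.cycle x ≠ F.cycle z) (h₁ : (iSup H).Adj x y)
    (h₂ : (iSup H).Adj y z) : (iSup H).Adj x z := by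
  obtain ⟨c, h₁ | h₁⟩ := F.dominates_or_dominates hH hxy h₁ <;>
    obtain ⟨d, h₂ | h₂⟩ := F.dominates_or_dominates hH hyz h₂
  · exact h₁.adj_iSup_of_dominates hH h₂ hxz
  · obtain ⟨z', hz', hd⟩ := h₂.exists_colour hH c
    have hxz' : F.cycle x ≠ F.cycle z' := hz' ▸ hxz
    exact F.adj_iSup_congr hH hxz'
      (F.adj_iSup_of_adj_of_adj hH hxz' (h₁.2 y rfl) (hd.2 y rfl).symm) rfl hz'
  · obtain rfl := h₁.colour_eq hH h₂
    exact F.adj_iSup_of_adj_of_adj hH hxz (h₁.2 x rfl).symm (h₂.2 z rfl)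
  · exact (h₂.adj_iSup_of_dominates hH h₁ hxz.symm).symm

theorem adj_iSup_of_altReach (hH : MClosedUpToTwins H) {c : Bool} {x y : V}
    (h : AltReach H c x y) (hxy : F.cycle x ≠ F.cycle y) : (iSup H).Adj x y := by
  induction h with
  | single h => exact adj_iSup h
  | @cons c u w v h _ ih =>
    by_cases huw : F.cycle u = F.cycle w
    · exact F.adj_iSup_congr hH (huw ▸ hxy) (ih (huw ▸ hxy)) huw.symm rfl
    by_cases hwv : F.cycle w = F.cycle v
    · exact F.adj_iSup_congr hH huw (adj_iSup h) rfl hwv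
    · exact F.adj_iSup_trans hH huw hwv hxy (adj_iSup h) (ih hwv)

namespace Dominates

variable {F} {c d : Bool} {x y z : V}

theorem exists_dominates_trans (hH : MClosedUpToTwins H) (h₁ : F.Dominates c x y)
    (h₂ : F.Dominates d y z) : ∃ e, F.Dominates e x z := by
  by_cases hxz : F.cycle x = F.cycle z
  · exact absurd h₂ (h₁.asymm hH hxz)
  obtain ⟨e, h | h⟩ := F.dominates_or_dominates hH hxz (h₁.adj_iSup_of_dominates hH h₂ hxz)
  · exact ⟨e, h⟩
  · obtain ⟨y', hy', h₂'⟩ := h₂.exists_colour hH c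
    obtain ⟨z', hz', h'⟩ := h.exists_colour hH c
    exact absurd h' ((h₁.congr_right hy'.symm).not_triangle (h₂'.congr_right hz'.symm))

/-- Otherwise the cycle of `y` could be inserted into the cycle of `x`, rerouted along the
edge `xz`. -/
theorem not_adj_same_class (hH : MClosedUpToTwins H) (h : F.Dominates c x y)
    (hxz : F.cycle x = F.cycle z) (hxz' : F.col x = F.col z) : ¬ (H (!c)).Adj x z := by
  intro hadj
  obtain ⟨S, T, hST, hx, hS, hT⟩ := F.exists_altSegment_split (!c) hxz hxz' hadj.ne
  have hpartner := h.partner hH (!c)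
  have hpartner' := (h.same_class hH hxz hxz').partner hH (!c)
  have hmerge := (hS.append hT.symm hST hadj.symm).append (F.altSegment_cycle (!c) y)
    (hx ▸ disjoint_cycle h.1) (hpartner'.2 _ (F.cycle_partner _ _))
  rw [hx] at hmerge
  exact F.not_altClosed_union h.1 ⟨_, _, _, hmerge, (hpartner.2 y rfl).symm⟩

end Dominates

theorem exists_dominating (hH : MClosedUpToTwins H)
    (hreach : ∀ u v c, u ≠ v → AltReach H c u v) [Nonempty V] :
    ∃ u c, ∀ v, F.cycle u ≠ F.cycle v → F.Dominates c u v := by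
  let r : V → V → Prop := fun x y => ∃ c, F.Dominates c x y
  have : IsTrans V r := ⟨fun _ _ _ ⟨_, h₁⟩ ⟨_, h₂⟩ => h₁.exists_dominates_trans hH h₂⟩
  have : Std.Irrefl r := ⟨fun _ ⟨_, h⟩ => h.1 rfl⟩
  obtain ⟨u, -, hu⟩ := (Finite.wellFounded_of_trans_of_irrefl r).has_min Set.univ
    Set.univ_nonempty
  have hdom : ∀ v, F.cycle u ≠ F.cycle v → ∃ c, F.Dominates c u v := by
    intro v huv
    have hadj := F.adj_iSup_of_altReach hH (hreach u v true (ne_of_apply_ne _ huv)) huv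
    obtain ⟨c, h | h⟩ := F.dominates_or_dominates hH huv hadj
    · exact ⟨c, h⟩
    · exact absurd ⟨c, h⟩ (hu v trivial)
  by_cases hsingle : ∃ v, F.cycle u ≠ F.cycle v
  · obtain ⟨v, huv⟩ := hsingle
    obtain ⟨c, hc⟩ := hdom v huv
    refine ⟨u, c, fun w huw => ?_⟩
    obtain ⟨d, hd⟩ := hdom w huw
    exact hc.colour_eq hH hd ▸ hd
  · exact ⟨u, true, fun v huv => absurd ⟨v, huv⟩ hsingle⟩

theorem cycle_eq_and_col_ne_of_adj (hH : MClosedUpToTwins H) {c : Bool} {u v w : V}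
    (huv : F.cycle u ≠ F.cycle v)
    (hdom : ∀ b, F.cycle u ≠ F.cycle b → F.Dominates (!c) u b) (h : (H c).Adj u w) :
    F.cycle u = F.cycle w ∧ F.col u ≠ F.col w := by
  have hcycle : F.cycle u = F.cycle w := by
    by_contra hw
    simpa using F.colour_eq_of_adj hH hw h ((hdom w hw).2 w rfl)
  refine ⟨hcycle, fun hcol => (hdom v huv).not_adj_same_class hH hcycle hcol ?_⟩
  rwa [Bool.not_not]

theorem cycle_eq_of_altReach (hH : MClosedUpToTwins H) {c : Bool} {u w : V}
    (h : AltReach H c u w) (hdom : ∀ b, F.cycle u ≠ F.cycle b → F.Dominates (!c) u b) :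
    F.cycle u = F.cycle w := by
  by_contra huw
  induction h with
  | single h => exact huw (F.cycle_eq_and_col_ne_of_adj hH huw hdom h).1
  | cons h _ ih =>
    obtain ⟨hcycle, hcol⟩ := F.cycle_eq_and_col_ne_of_adj hH huw hdom h
    rw [hcycle] at huw hdom
    exact ih (fun b hb => (hdom b hb).other_class hH hcycle hcol) huw

theorem cycle_eq (hH : MClosedUpToTwins H) (hreach : ∀ u v c, u ≠ v → AltReach H c u v)
    (x y : V) : F.cycle x = F.cycle y := by
  have : Nonempty V := ⟨x⟩
  obtain ⟨u, c, hu⟩ := F.exists_dominating hH hreach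
  have hall : ∀ v, F.cycle u = F.cycle v := by
    intro v
    obtain rfl | huv := eq_or_ne u v
    · rfl
    · exact F.cycle_eq_of_altReach hH (hreach u v (!c) huv) (by rwa [Bool.not_not])
  exact (hall x).symm.trans (hall y)

end IrreducibleFactor

end Abstract

section Walks

variable {γ δ : Type*} {G : Graph γ δ} {φ : δ → Fin 2}

theorem isWalkList_append {u m v : γ} {w w' : List (δ × γ)} (h : G.IsWalkList u w m)
    (h' : G.IsWalkList m w' v) : G.IsWalkList u (w ++ w') v := by
  induction w generalizing u with
  | nil => obtain ⟨-, rfl⟩ := h; exact h'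
  | cons s w ih => exact ⟨h.1, ih h.2⟩

theorem isWalkList_singleton {u v : γ} {e : δ} (h : G.IsLink e u v) : G.IsWalkList u [(e, v)] v :=
  ⟨h, h.right_mem, rfl⟩

theorem exists_isWalkList_of_append {u v : γ} {w w' : List (δ × γ)}
    (h : G.IsWalkList u (w ++ w') v) : ∃ m, G.IsWalkList u w m ∧ G.IsWalkList m w' v := by
  induction w generalizing u with
  | nil =>
    refine ⟨u, ⟨?_, rfl⟩, h⟩
    cases w' with
    | nil => exact h.1
    | cons s w' => exact h.1.left_mem
  | cons s w ih =>
    obtain ⟨m, h₁, h₂⟩ := ih h.2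
    exact ⟨m, ⟨h.1, h₁⟩, h₂⟩

theorem exists_isWalkList_reverse {u v : γ} {w : List (δ × γ)} (h : G.IsWalkList v w u) :
    ∃ q, G.IsWalkList u q v ∧ Graph.colourSeq φ q = (Graph.colourSeq φ w).reverse ∧
      u :: q.map Prod.snd = (v :: w.map Prod.snd).reverse := by
  induction w generalizing v with
  | nil =>
    obtain ⟨h, rfl⟩ := h
    exact ⟨[], ⟨h, rfl⟩, rfl, rfl⟩
  | cons s w ih =>
    obtain ⟨q, hq, hcol, hverts⟩ := ih h.2
    refine ⟨q ++ [(s.1, v)], isWalkList_append hq (isWalkList_singleton h.1.symm), ?_, ?_⟩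
    · simp only [Graph.colourSeq] at hcol
      simp [Graph.colourSeq, hcol]
    · rw [List.map_append, ← List.cons_append, hverts]
      simp

theorem target_mem_of_isWalkList {u v : γ} {w : List (δ × γ)} (h : G.IsWalkList u w v) :
    v ∈ u :: w.map Prod.snd := by
  induction w generalizing u with
  | nil => exact List.mem_singleton.2 h.2.symm
  | cons s w ih => exact List.mem_cons_of_mem _ (ih h.2)

theorem isChain_isLink_of_isWalkList {s : δ × γ} {v : γ} {w : List (δ × γ)}
    (h : G.IsWalkList s.2 w v) : (s :: w).IsChain fun s t => G.IsLink t.1 s.2 t.2 := by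
  induction w generalizing s with
  | nil => exact .singleton _
  | cons t w ih => exact List.isChain_cons_cons.2 ⟨h.1, ih h.2⟩

theorem cycleChain_isLink_of_isWalkList {u : γ} {w : List (δ × γ)} (h : G.IsWalkList u w u) :
    Cycle.Chain (fun s t => G.IsLink t.1 s.2 t.2) (w : Cycle (δ × γ)) := by
  cases w with
  | nil => exact Cycle.Chain.nil _
  | cons s w =>
    rw [Cycle.chain_coe_cons]
    exact isChain_isLink_of_isWalkList (isWalkList_append h.2 (isWalkList_singleton h.1))

end Walks

section CycleChain

variable {α : Type*} {r : α → α → Prop}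

theorem isChain_of_cycleChain {l : List α} (h : Cycle.Chain r (l : Cycle α)) : l.IsChain r := by
  cases l with
  | nil => exact .nil
  | cons a l =>
    rw [Cycle.chain_coe_cons, ← List.cons_append] at h
    exact (List.isChain_append.1 h).1

theorem rel_head_head_of_cycleChain {a b : α} {l₁ l₂ : List α}
    (h : Cycle.Chain r (a :: l₁ ++ (b :: l₂).reverse : Cycle α)) : r b a := by
  have hrot : (a :: l₁ ++ (b :: l₂).reverse) ~r (b :: (a :: l₁ ++ l₂.reverse)) := by
    rw [List.reverse_cons, ← List.append_assoc]
    exact List.isRotated_append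
  rw [Cycle.coe_eq_coe.2 hrot, Cycle.chain_coe_cons] at h
  exact (List.isChain_cons_cons.1 h).1

theorem cycleChain_and {r' : α → α → Prop} {l : List α} (h : Cycle.Chain r (l : Cycle α))
    (h' : Cycle.Chain r' (l : Cycle α)) :
    Cycle.Chain (fun a b => r a b ∧ r' a b) (l : Cycle α) := by
  cases l with
  | nil => exact Cycle.Chain.nil _
  | cons a l =>
    rw [Cycle.chain_coe_cons, List.isChain_iff_getElem] at h h' ⊢
    exact fun i hi => ⟨h i hi, h' i hi⟩

theorem rel_getElem_of_cycleChain {l : List α} (h : Cycle.Chain r (l : Cycle α)) (i : ℕ)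
    (hi : i < l.length) : r l[i] (l[(i + 1) % l.length]'(Nat.mod_lt _ (by lia))) := by
  cases l with
  | nil => simp at hi
  | cons a l =>
    rw [Cycle.chain_coe_cons, ← List.cons_append, List.isChain_iff_getElem] at h
    have hrel := h i (by simpa using hi)
    rw [List.getElem_append_left hi] at hrel
    by_cases hlast : i + 1 < (a :: l).length
    · simp only [Nat.mod_eq_of_lt hlast]
      rwa [List.getElem_append_left hlast] at hrel
    · obtain rfl : i = l.length := by simp only [List.length_cons] at hi hlast; lia
      simpa using hrel

theorem exists_isCycleOn_of_cycleChain {V : Type*} {r : α × V → α × V → Prop} {w : List (α × V)}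
    (hnodup : (w.map Prod.snd).Nodup) (hlen : 3 ≤ w.length)
    (hchain : Cycle.Chain r (w : Cycle (α × V))) :
    ∃ (σ : Equiv.Perm V) (f : V → α), σ.IsCycleOn {x | x ∈ w.map Prod.snd} ∧
      ∀ x ∈ w.map Prod.snd, r (f x, x) (f (σ x), σ x) ∧ σ (σ x) ≠ x := by
  classical
  have hnext (i : ℕ) (hi : i < w.length) :
      (w.map Prod.snd).formPerm w[i].2 = (w[(i + 1) % w.length]'(Nat.mod_lt _ (by lia))).2 := by
    have h := List.formPerm_apply_getElem _ hnodup i (by simpa using hi)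
    simpa only [List.getElem_map, List.length_map] using h
  obtain ⟨f, hf⟩ : ∃ f : V → α, ∀ s ∈ w, f s.2 = s.1 := by
    have : Nonempty (α × V) := ⟨w[0]⟩
    have hinj : Set.InjOn Prod.snd {s | s ∈ w} := fun s hs t ht =>
      List.inj_on_of_nodup_map hnodup hs ht
    exact ⟨fun x => (Function.invFunOn Prod.snd {s | s ∈ w} x).1, fun s hs =>
      congrArg Prod.fst (hinj.leftInvOn_invFunOn hs)⟩
  refine ⟨(w.map Prod.snd).formPerm, f, hnodup.isCycleOn_formPerm, fun x hx => ?_⟩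
  obtain ⟨s, hs, rfl⟩ := List.mem_map.1 hx
  obtain ⟨i, hi, rfl⟩ := List.getElem_of_mem hs
  constructor
  · rw [hnext i hi, hf _ hs, hf _ (List.getElem_mem _)]
    exact rel_getElem_of_cycleChain hchain i hi
  · intro h
    have hcycle : (w.map Prod.snd).formPerm.IsCycleOn (w.map Prod.snd).toFinset := by
      rw [List.coe_toFinset]
      exact hnodup.isCycleOn_formPerm
    have hdvd := (hcycle.pow_apply_eq (List.mem_toFinset.2 hx) (n := 2)).1 h
    rw [List.toFinset_card_of_nodup hnodup, List.length_map] at hdvd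
    have := Nat.le_of_dvd two_pos hdvd
    lia

end CycleChain

section Setoid

variable {V : Type*}

theorem exists_perm_sameCycle_iff [Finite V] (s : Setoid V) (σ : Quotient s → Equiv.Perm V)
    (hσ : ∀ q, (σ q).IsCycleOn {z | ⟦z⟧ = q}) :
    ∃ τ : Equiv.Perm V, (∀ x, τ x = σ ⟦x⟧ x) ∧ ∀ x y, τ.SameCycle x y ↔ s x y := by
  have hmk (x : V) : (⟦σ ⟦x⟧ x⟧ : Quotient s) = ⟦x⟧ := (hσ ⟦x⟧).1.mapsTo rfl
  have hmk_symm (x : V) : (⟦(σ ⟦x⟧).symm x⟧ : Quotient s) = ⟦x⟧ :=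
    (hσ ⟦x⟧).1.perm_inv.mapsTo rfl
  let τ : Equiv.Perm V :=
    { toFun := fun x => σ ⟦x⟧ x
      invFun := fun x => (σ ⟦x⟧).symm x
      left_inv := fun x => by simp only [hmk, Equiv.symm_apply_apply]
      right_inv := fun x => by simp only [hmk_symm, Equiv.apply_symm_apply] }
  have hpow (x : V) (n : ℕ) : (τ ^ n) x = (σ ⟦x⟧ ^ n) x ∧ (⟦(τ ^ n) x⟧ : Quotient s) = ⟦x⟧ := by
    induction n with
    | zero => exact ⟨rfl, rfl⟩
    | succ n ih =>
      rw [pow_succ', pow_succ', Equiv.Perm.mul_apply, Equiv.Perm.mul_apply, ← ih.1, ← ih.2]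
      exact ⟨rfl, hmk _⟩
  refine ⟨τ, fun x => rfl, fun x y => ⟨fun h => ?_, fun h => ?_⟩⟩
  · obtain ⟨n, rfl⟩ := h.exists_nat_pow_eq
    exact Quotient.exact (hpow x n).2.symm
  · obtain ⟨n, -, rfl⟩ :=
      (hσ ⟦x⟧).exists_pow_eq' (Set.toFinite _) rfl (Quotient.sound (s.symm h))
    exact ⟨n, by rw [zpow_natCast, (hpow x n).1]⟩

theorem exists_setoid_iff_or_mem {s : Setoid V} {T : Set V} (hT : ∀ x y, s x y → y ∈ T → x ∈ T) :
    ∃ t : Setoid V, ∀ x y, t x y ↔ s x y ∨ x ∈ T ∧ y ∈ T := by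
  refine ⟨⟨fun x y => s x y ∨ x ∈ T ∧ y ∈ T, ?_, ?_, ?_⟩, fun _ _ => Iff.rfl⟩
  · exact fun x => .inl (s.refl x)
  · exact fun h => h.imp s.symm And.symm
  · rintro x y z (hxy | ⟨hx, hy⟩) (hyz | ⟨hy', hz⟩)
    · exact .inl (s.trans hxy hyz)
    · exact .inr ⟨hT x y hxy hy', hz⟩
    · exact .inr ⟨hx, hT z y (s.symm hyz) hy⟩
    · exact .inr ⟨hx, hz⟩

end Setoid

section ColourGraph

variable {γ δ : Type*} {G : Graph γ δ} {φ : δ → Fin 2}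

theorem finTwoEquiv_eq_not_iff {i j : Fin 2} : finTwoEquiv j = !finTwoEquiv i ↔ i ≠ j := by
  revert i j; decide

/-- The simple graph of the pairs of vertices of `G` that are joined by an edge of colour `c`.
The colours `0` and `1` are encoded as `false` and `true`, so that `!c` is the other colour. -/
def colourGraph (G : Graph γ δ) (φ : δ → Fin 2) (c : Bool) : SimpleGraph G.vertexSet where
  Adj x y := x ≠ y ∧ ∃ e, G.IsLink e x y ∧ finTwoEquiv (φ e) = c
  symm := ⟨fun _ _ ⟨hne, e, he, hc⟩ => ⟨hne.symm, e, he.symm, hc⟩⟩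
  loopless := ⟨fun _ h => h.1 rfl⟩

/-- `S` is the vertex set of an alternating cycle of `G`. -/
def IsAltCycleSet (G : Graph γ δ) (φ : δ → Fin 2) (S : Set G.vertexSet) : Prop :=
  ∃ w, G.IsAltCycle φ w ∧ Graph.cycleVerts w = Subtype.val '' S

section OfSegment

theorem exists_isWalkList_of_altSegment {i : Fin 2} {S : Set G.vertexSet} {a b : G.vertexSet}
    (h : AltSegment (colourGraph G φ) (finTwoEquiv i) S a b) :
    ∃ w, G.IsWalkList a w b ∧ ((a : γ) :: w.map Prod.snd).Nodup ∧
      {x | x ∈ (a : γ) :: w.map Prod.snd} = Subtype.val '' S ∧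
      (i :: (Graph.colourSeq φ w ++ [i])).IsChain (· ≠ ·) := by
  induction h with
  | @edge a b h =>
    obtain ⟨hab, e, he, hc⟩ := h
    refine ⟨[(e, b)], isWalkList_singleton he, ?_, ?_, ?_⟩
    · simpa using fun h => hab (Subtype.ext h)
    · ext x
      simp [Set.image_pair]
    · have hne : i ≠ φ e := finTwoEquiv_eq_not_iff.1 hc
      simp [Graph.colourSeq, hne, hne.symm]
  | @append S T a b d e _ _ hST hbd ih₁ ih₂ =>
    obtain ⟨w₁, hw₁, hnodup₁, hverts₁, hchain₁⟩ := ih₁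
    obtain ⟨w₂, hw₂, hnodup₂, hverts₂, hchain₂⟩ := ih₂
    obtain ⟨-, g, hg, hgc⟩ := hbd
    obtain rfl : φ g = i := finTwoEquiv.injective hgc
    have hdisj := (Set.disjoint_image_iff Subtype.val_injective).2 hST
    rw [← hverts₁, ← hverts₂] at hdisj
    refine ⟨w₁ ++ (g, (d : γ)) :: w₂, isWalkList_append hw₁ ⟨hg, hw₂⟩, ?_, ?_, ?_⟩
    · rw [List.map_append, List.map_cons, ← List.cons_append]
      exact List.nodup_append'.2 ⟨hnodup₁, hnodup₂, fun x h h' => Set.disjoint_left.1 hdisj h h'⟩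
    · rw [Set.image_union, ← hverts₁, ← hverts₂]
      ext x
      simp [or_assoc]
    · have hchain := hchain₁.append_overlap (l₁ := φ g :: Graph.colourSeq φ w₁) (l₂ := [φ g])
        (l₃ := Graph.colourSeq φ w₂ ++ [φ g]) hchain₂ (by simp)
      simpa [Graph.colourSeq] using hchain

theorem ncard_cycleVerts {w : List (δ × γ)} (h : (w.map Prod.snd).Nodup) :
    (Graph.cycleVerts w).ncard = w.length := by
  classical
  have hcoe : Graph.cycleVerts w = ((w.map Prod.snd).toFinset : Set γ) := by
    ext x
    exact List.mem_toFinset.symm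
  rw [hcoe, Set.ncard_coe_finset, List.toFinset_card_of_nodup h, List.length_map]

theorem isAltCycleSet_of_altClosed {S : Set G.vertexSet} (h : AltClosed (colourGraph G φ) S)
    (hS : 3 ≤ S.ncard) : IsAltCycleSet G φ S := by
  obtain ⟨_, a, b, hseg, -, e, he, rfl⟩ := h
  obtain ⟨w, hw, hnodup, hverts, hchain⟩ := exists_isWalkList_of_altSegment hseg
  have hperm : ((w ++ [(e, (a : γ))]).map Prod.snd).Perm ((a : γ) :: w.map Prod.snd) := by
    rw [List.map_append]
    exact List.perm_append_singleton _ _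
  have hverts' : Graph.cycleVerts (w ++ [(e, (a : γ))]) = Subtype.val '' S := by
    rw [← hverts]
    ext x
    exact hperm.mem_iff
  have hnodup' := hperm.nodup_iff.2 hnodup
  refine ⟨w ++ [(e, (a : γ))],
    ⟨⟨a, isWalkList_append hw (isWalkList_singleton he)⟩, ?_, hnodup', ?_⟩, hverts'⟩
  · rwa [← ncard_cycleVerts hnodup', hverts', Set.ncard_image_of_injective _ Subtype.val_injective]
  · have hrot : Graph.colourSeq φ (w ++ [(e, (a : γ))]) ~r (φ e :: Graph.colourSeq φ w) := by
      rw [Graph.colourSeq, List.map_append]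
      exact (List.isRotated_append (l := [φ e])).symm
    rwa [Cycle.coe_eq_coe.2 hrot, Cycle.chain_coe_cons]

end OfSegment

theorem exists_isCycleOn_of_isAltCycleSet {S : Set G.vertexSet} (h : IsAltCycleSet G φ S) :
    ∃ (σ : Equiv.Perm G.vertexSet) (col : G.vertexSet → Bool), σ.IsCycleOn S ∧
      ∀ x ∈ S, (colourGraph G φ (col x)).Adj x (σ x) ∧ col (σ x) = !col x ∧ σ (σ x) ≠ x := by
  obtain ⟨w, ⟨⟨u, hwalk⟩, hlen, hnodup, halt⟩, hverts⟩ := h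
  have hlink := cycleChain_isLink_of_isWalkList hwalk
  obtain ⟨w, rfl⟩ : ∃ w' : List (δ × G.vertexSet), w'.map (Prod.map id Subtype.val) = w := by
    rw [← Set.mem_range, Set.range_list_map]
    rintro ⟨e, x⟩ hx
    obtain ⟨y, -, rfl⟩ := hverts.subset (List.mem_map_of_mem hx)
    exact ⟨(e, y), rfl⟩
  have hsnd : (w.map (Prod.map id Subtype.val)).map Prod.snd =
      (w.map Prod.snd).map (Subtype.val : G.vertexSet → γ) := by
    rw [List.map_map, List.map_map, Prod.map_snd']
  rw [hsnd] at hnodup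
  rw [← Cycle.map_coe, Cycle.chain_map] at hlink
  rw [Graph.colourSeq, List.map_map, ← Cycle.map_coe, Cycle.chain_map] at halt
  rw [List.length_map] at hlen
  obtain rfl : {x | x ∈ w.map Prod.snd} = S := by
    apply Set.image_injective.2 Subtype.val_injective
    rw [← hverts]
    ext z
    simp only [Graph.cycleVerts, hsnd, List.mem_map, Set.mem_image, Set.mem_ofPred_eq]
  obtain ⟨σ, f, hσ, h⟩ :=
    exists_isCycleOn_of_cycleChain (.of_map _ hnodup) hlen (cycleChain_and hlink halt)
  refine ⟨σ, fun x => finTwoEquiv (φ (f (σ x))), hσ, fun x hx => ⟨⟨?_, ?_⟩, ?_, (h x hx).2⟩⟩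
  · exact fun hfix => (h x hx).2 (by rw [← hfix, ← hfix])
  · exact ⟨_, (h x hx).1.1, rfl⟩
  · exact finTwoEquiv_eq_not_iff.2 (h _ (hσ.1.mapsTo hx)).1.2

section Gluing

variable [Finite G.vertexSet]

theorem exists_altCycleFactor (s : Setoid G.vertexSet)
    (hs : ∀ x, IsAltCycleSet G φ {z | s z x}) :
    ∃ F : AltCycleFactor (colourGraph G φ), ∀ x, F.cycle x = {z | s z x} := by
  choose σ col hσ h using fun x : Quotient s => exists_isCycleOn_of_isAltCycleSet (hs x.out)
  have hclass (q : Quotient s) : {z | s z q.out} = {z | ⟦z⟧ = q} :=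
    Set.ext fun _ => Quotient.mk_eq_iff_out.symm
  simp only [hclass] at hσ h
  obtain ⟨τ, hτ, hcycle⟩ := exists_perm_sameCycle_iff s σ hσ
  have hmk (x : G.vertexSet) : (⟦τ x⟧ : Quotient s) = ⟦x⟧ :=
    Quotient.sound ((hcycle _ _).1 (Equiv.Perm.sameCycle_apply_left.2 (.refl _ _)))
  let F : AltCycleFactor (colourGraph G φ) :=
    { next := τ
      col := fun x => col ⟦x⟧ x
      adj_next := fun x => hτ x ▸ (h ⟦x⟧ x rfl).1
      col_next := fun x => by rw [hmk, hτ]; exact (h ⟦x⟧ x rfl).2.1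
      next_next_ne := fun x => by rw [hτ (τ x), hmk, hτ]; exact (h ⟦x⟧ x rfl).2.2 }
  exact ⟨F, fun x => Set.ext fun z => (hcycle x z).trans ⟨s.symm, s.symm⟩⟩

theorem isAltCycleSet_of_cycle_subset (F : AltCycleFactor (colourGraph G φ)) {x : G.vertexSet}
    {T : Set G.vertexSet} (hT : F.cycle x ⊆ T) (h : AltClosed (colourGraph G φ) T) :
    IsAltCycleSet G φ T := by
  refine isAltCycleSet_of_altClosed h ((Set.two_lt_ncard T.toFinite).2 ?_)
  exact ⟨x, hT (F.self_mem_cycle x), F.next x, hT (AltCycleFactor.mem_cycle.2 (F.cycle_next x)),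
    F.next (F.next x), hT (AltCycleFactor.mem_cycle.2 (by rw [F.cycle_next, F.cycle_next])),
    (F.adj_next x).ne, (F.next_next_ne x).symm, (F.adj_next (F.next x)).ne⟩

theorem isAltCycleSet_cycle (F : AltCycleFactor (colourGraph G φ)) (x : G.vertexSet) :
    IsAltCycleSet G φ (F.cycle x) :=
  isAltCycleSet_of_cycle_subset F subset_rfl
    ⟨true, _, _, F.altSegment_cycle true x, F.adj_partner true x⟩

theorem exists_irreducibleFactor (s₀ : Setoid G.vertexSet)
    (hs₀ : ∀ x, IsAltCycleSet G φ {z | s₀ z x}) :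
    Nonempty (IrreducibleFactor (colourGraph G φ)) := by
  have : Finite (Setoid G.vertexSet) :=
    .of_injective (fun s => s.r) fun s t h => Setoid.ext fun x y => iff_of_eq (congrFun₂ h x y)
  obtain ⟨s, hs, hmax⟩ :=
    (Set.toFinite {s : Setoid G.vertexSet | ∀ x, IsAltCycleSet G φ {z | s z x}}).exists_maximal
      ⟨s₀, hs₀⟩
  obtain ⟨F, hF⟩ := exists_altCycleFactor s hs
  refine ⟨F, fun T hT x hx y hy hxy hclosed => hxy ?_⟩
  obtain ⟨t, ht⟩ := exists_setoid_iff_or_mem (s := s) (T := T) fun z w hzw hw =>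
    hT w hw (by rw [hF]; exact hzw)
  have htcycle (z : G.vertexSet) : IsAltCycleSet G φ {w | t w z} := by
    by_cases hz : z ∈ T
    · have hclass : {w | t w z} = T := by
        ext w
        have hwz : s w z → w ∈ T := fun h => hT z hz (by rw [hF]; exact h)
        simp only [Set.mem_ofPred_eq, ht, hz, and_true, or_iff_right_of_imp hwz]
      rw [hclass]
      exact isAltCycleSet_of_cycle_subset F (hT x hx) hclosed
    · simpa only [ht, hz, and_false, or_false] using hs z
  have hts : t ≤ s := hmax htcycle fun z w h => (ht z w).2 (.inl h)
  rw [← AltCycleFactor.mem_cycle, hF]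
  exact hts ((ht x y).2 (.inr ⟨hx, hy⟩))

end Gluing

theorem exists_setoid_of_hasAltCycleFactor (h : G.HasAltCycleFactor φ) :
    ∃ s : Setoid G.vertexSet, ∀ x, IsAltCycleSet G φ {z | s z x} := by
  obtain ⟨C, hC, hdisj, hcover⟩ := h
  have hmem (x : G.vertexSet) : ∃ w ∈ C, (x : γ) ∈ Graph.cycleVerts w := by
    simpa only [Set.mem_iUnion₂, exists_prop] using hcover.symm.subset x.2
  have hunique {w w' : List (δ × γ)} {x : γ} (hw : w ∈ C) (hw' : w' ∈ C)
      (hx : x ∈ Graph.cycleVerts w) (hx' : x ∈ Graph.cycleVerts w') : w = w' :=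
    hdisj.elim_set hw hw' x hx hx'
  let s : Setoid G.vertexSet :=
    { r := fun x y => ∃ w ∈ C, (x : γ) ∈ Graph.cycleVerts w ∧ (y : γ) ∈ Graph.cycleVerts w
      iseqv :=
        { refl := fun x => (hmem x).imp fun w hw => ⟨hw.1, hw.2, hw.2⟩
          symm := fun ⟨w, hw, hx, hy⟩ => ⟨w, hw, hy, hx⟩
          trans := fun ⟨w, hw, hx, hy⟩ ⟨w', hw', hy', hz⟩ =>
            ⟨w, hw, hx, hunique hw hw' hy hy' ▸ hz⟩ } }
  refine ⟨s, fun x => ?_⟩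
  obtain ⟨w, hw, hx⟩ := hmem x
  refine ⟨w, hC w hw, ?_⟩
  ext z
  constructor
  · intro hz
    exact ⟨⟨z, hcover.subset (Set.mem_biUnion hw hz)⟩, ⟨w, hw, hz, hx⟩, rfl⟩
  · rintro ⟨z, ⟨w', hw', hz, hx'⟩, rfl⟩
    exact hunique hw hw' hx hx' ▸ hz

section ColourConnected

theorem altReach_of_isAltPath {u v : G.vertexSet} {e : δ} {x : γ} {w : List (δ × γ)}
    (h : G.IsAltPath φ u ((e, x) :: w) v) :
    AltReach (colourGraph G φ) (finTwoEquiv (φ e)) u v := by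
  induction w generalizing u e x with
  | nil =>
    obtain ⟨⟨hlink, -, rfl⟩, hnodup, -⟩ := h
    refine .single ⟨fun huv => ?_, e, hlink, rfl⟩
    simp [huv] at hnodup
  | cons s w ih =>
    obtain ⟨⟨hlink, hwalk⟩, hnodup, halt⟩ := h
    simp only [Graph.colourSeq, List.map_cons, List.isChain_cons_cons] at halt
    refine .cons (w := ⟨x, hlink.right_mem⟩) ⟨?_, e, hlink, rfl⟩ ?_
    · intro hux
      simp [hux] at hnodup
    · rw [← finTwoEquiv_eq_not_iff.2 halt.1]
      exact ih ⟨hwalk, hnodup.of_cons, halt.2⟩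

theorem altReach_of_colourConnected (h : G.ColourConnected φ) {u v : G.vertexSet} (c : Bool)
    (huv : u ≠ v) : AltReach (colourGraph G φ) c u v := by
  obtain ⟨p, q, hp, hq, hpq⟩ := h u u.2 v v.2 (Subtype.coe_ne_coe.2 huv)
  cases p with
  | nil => exact absurd (Subtype.ext hp.walk.2) huv
  | cons s p =>
    cases q with
    | nil => exact absurd (Subtype.ext hq.walk.2) huv
    | cons t q =>
      have hcol := finTwoEquiv_eq_not_iff.2 (rel_head_head_of_cycleChain hpq)
      obtain rfl | hc := Bool.eq_or_eq_not c (finTwoEquiv (φ t.1))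
      · exact altReach_of_isAltPath hq
      · rw [hc, ← hcol]
        exact altReach_of_isAltPath hp

theorem exists_isRotated_isWalkList {w : List (δ × γ)} (h : G.IsAltCycle φ w) {u : γ}
    (hu : u ∈ Graph.cycleVerts w) : ∃ w', G.IsWalkList u w' u ∧ w ~r w' := by
  obtain ⟨⟨e, x⟩, hs, rfl⟩ := List.mem_map.1 hu
  obtain ⟨l₁, l₂, rfl⟩ := List.append_of_mem hs
  obtain ⟨t, ht⟩ := h.closed
  obtain ⟨m, h₁, h₂, h₃⟩ := exists_isWalkList_of_append ht
  refine ⟨l₂ ++ (l₁ ++ [(e, x)]),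
    isWalkList_append h₃ (isWalkList_append h₁ (isWalkList_singleton h₂)), ?_⟩
  rw [← List.singleton_append (x := (e, x)), ← List.append_assoc]
  exact List.isRotated_append

theorem exists_isWalkList_split_of_isAltCycle {w : List (δ × γ)} (h : G.IsAltCycle φ w) {u v : γ}
    (hu : u ∈ Graph.cycleVerts w) (hv : v ∈ Graph.cycleVerts w) :
    ∃ p r, G.IsWalkList u p v ∧ G.IsWalkList v r u ∧ ((p ++ r).map Prod.snd).Nodup ∧
      Cycle.Chain (· ≠ ·) (Graph.colourSeq φ (p ++ r) : Cycle (Fin 2)) := by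
  obtain ⟨w', hw', hrot⟩ := exists_isRotated_isWalkList h hu
  have hnodup : (w'.map Prod.snd).Nodup := (hrot.perm.map _).nodup_iff.1 h.nodup
  have halt : Cycle.Chain (· ≠ ·) (Graph.colourSeq φ w' : Cycle (Fin 2)) := by
    rw [Graph.colourSeq, ← Cycle.coe_eq_coe.2 (hrot.map _)]
    exact h.alternating
  obtain ⟨⟨f, v⟩, hs, rfl⟩ := List.mem_map.1 ((hrot.perm.map _).mem_iff.1 hv)
  obtain ⟨p, r, rfl⟩ := List.append_of_mem hs
  obtain ⟨m, h₁, h₂, h₃⟩ := exists_isWalkList_of_append hw'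
  rw [← List.singleton_append (x := (f, v)), ← List.append_assoc] at hnodup halt
  exact ⟨p ++ [(f, v)], r, isWalkList_append h₁ (isWalkList_singleton h₂), h₃, hnodup, halt⟩

theorem colourConnected_of_hasAltHamCycle (h : G.HasAltHamCycle φ) : G.ColourConnected φ := by
  obtain ⟨w, hw, hverts⟩ := h
  intro u hu v hv huv
  rw [← hverts] at hu hv
  obtain ⟨p, r, hp, hr, hnodup, halt⟩ := exists_isWalkList_split_of_isAltCycle hw hu hv
  obtain ⟨q, hq, hqcol, hqverts⟩ := exists_isWalkList_reverse (φ := φ) hr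
  have hvp : v ∈ p.map Prod.snd :=
    List.mem_of_ne_of_mem huv.symm (target_mem_of_isWalkList hp)
  have hur : u ∈ r.map Prod.snd := List.mem_of_ne_of_mem huv (target_mem_of_isWalkList hr)
  have hchain := isChain_of_cycleChain halt
  rw [Graph.colourSeq, List.map_append] at hchain halt
  rw [List.map_append] at hnodup
  obtain ⟨hchain_p, hchain_r, -⟩ := List.isChain_append.1 hchain
  obtain ⟨hnodup_p, hnodup_r, hdisj⟩ := List.nodup_append'.1 hnodup
  refine ⟨p, q, ⟨hp, ?_, hchain_p⟩, ⟨hq, ?_, ?_⟩, ?_⟩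
  · exact List.nodup_cons.2 ⟨fun h => hdisj h hur, hnodup_p⟩
  · rw [hqverts, List.nodup_reverse]
    exact List.nodup_cons.2 ⟨fun h => hdisj hvp h, hnodup_r⟩
  · rw [hqcol, List.isChain_reverse]
    exact hchain_r.imp fun _ _ h => h.symm
  · rwa [hqcol, List.reverse_reverse]

end ColourConnected

theorem hasAltCycleFactor_of_hasAltHamCycle (h : G.HasAltHamCycle φ) : G.HasAltCycleFactor φ := by
  obtain ⟨w, hw, hverts⟩ := h
  exact ⟨{w}, fun _ hw' => hw' ▸ hw, Set.pairwiseDisjoint_singleton _ _,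
    (Set.biUnion_singleton _ _).trans hverts⟩

section Extension

variable {α β : Type*} {G₀ : Graph α β} {φ₀ : β → Fin 2}

theorem exists_colourGraph_adj_iff (hG : G₀.IsExtension φ₀ G φ) :
    ∃ π : G.vertexSet → α, ∀ c x y, (colourGraph G φ c).Adj x y ↔
      x ≠ y ∧ ∃ e, G₀.IsLink e (π x) (π y) ∧ finTwoEquiv (φ₀ e) = c := by
  obtain ⟨π, -, hπ⟩ := hG
  refine ⟨fun x => π x, fun c x y => and_congr_right fun _ => ?_⟩
  have hnonempty : {f | G.IsLink f x y ∧ φ f = finTwoEquiv.symm c}.Nonempty ↔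
      {e | G₀.IsLink e (π x) (π y) ∧ φ₀ e = finTwoEquiv.symm c}.Nonempty := by
    rw [← Set.encard_ne_zero, ← Set.encard_ne_zero, hπ x x.2 y y.2]
  simpa only [Equiv.eq_symm_apply, Set.Nonempty, Set.mem_ofPred_eq] using hnonempty

theorem mClosedUpToTwins_of_isExtension (hM : G₀.MClosed φ₀) (hG : G₀.IsExtension φ₀ G φ) :
    MClosedUpToTwins (colourGraph G φ) := by
  obtain ⟨π, hπ⟩ := exists_colourGraph_adj_iff hG
  intro c x y z hxy hyz
  obtain ⟨-, e, he, hec⟩ := (hπ c x y).1 hxy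
  obtain ⟨-, f, hf, hfc⟩ := (hπ c y z).1 hyz
  refine or_iff_not_imp_left.2 fun hnadj d w => ?_
  obtain rfl | hxz := eq_or_ne x z
  · rfl
  have hnlink (g : β) : ¬ G₀.IsLink g (π x) (π z) := fun hg =>
    hnadj (adj_iSup ((hπ _ x z).2 ⟨hxz, g, hg, rfl⟩))
  have hxy' : π x ≠ π y := fun h => hnlink f (h ▸ hf)
  have hyz' : π y ≠ π z := fun h => hnlink e (h ▸ he)
  have hxz' : π x = π z := by
    by_contra hne
    obtain ⟨g, hg⟩ :=
      hM e f _ _ _ he hf hxy' hyz' hne (finTwoEquiv.injective (hec.trans hfc.symm))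
    exact hnlink g hg
  rw [hπ, hπ, hxz']
  refine and_congr_left fun ⟨g, hg, _⟩ => iff_of_true ?_ ?_ <;> rintro rfl <;> apply hnlink g
  · exact hg.symm
  · rwa [hxz']

end Extension

end ColourGraph

end AltColour

open AltColour in
theorem mainTheorem2_general {γ δ : Type*} (G : Graph γ δ) (φ : δ → Fin 2)
    (hfin : G.vertexSet.Finite) (hne : G.vertexSet.Nonempty)
    (hG : MClosedUpToTwins (colourGraph G φ)) :
    G.HasAltHamCycle φ ↔ G.ColourConnected φ ∧ G.HasAltCycleFactor φ := by
  refine ⟨fun h => ⟨colourConnected_of_hasAltHamCycle h, hasAltCycleFactor_of_hasAltHamCycle h⟩,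
    fun ⟨hconn, hfactor⟩ => ?_⟩
  have : Finite G.vertexSet := hfin
  obtain ⟨x⟩ := hne.to_subtype
  obtain ⟨s, hs⟩ := exists_setoid_of_hasAltCycleFactor hfactor
  obtain ⟨F⟩ := exists_irreducibleFactor s hs
  have hcycle : F.cycle x = Set.univ := Set.eq_univ_of_forall fun z =>
    AltCycleFactor.mem_cycle.2 <|
      F.cycle_eq hG (fun _ _ c => altReach_of_colourConnected hconn c) z x
  obtain ⟨w, hw, hverts⟩ := isAltCycleSet_cycle F.toAltCycleFactor x
  exact ⟨w, hw, by rw [hverts, hcycle, Subtype.coe_image_univ]⟩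

theorem mainTheorem2 {α β γ δ : Type*}
    (G₀ : Graph α β) [G₀.Loopless] (φ₀ : β → Fin 2) (hM : G₀.MClosed φ₀)
    (G : Graph γ δ) (φ : δ → Fin 2) (hfin : G.vertexSet.Finite) (hne : G.vertexSet.Nonempty)
    (hG : G₀.IsExtension φ₀ G φ) :
    G.HasAltHamCycle φ ↔ G.ColourConnected φ ∧ G.HasAltCycleFactor φ :=
  mainTheorem2_general G φ hfin hne (AltColour.mClosedUpToTwins_of_isExtension hM hG)
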